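/- Let $G$ be a finite group with $|G|\ge 4$, let $\sigma$ be an automorphism of $G$ with $\sigma^2=\mathrm{id}$ (for instance an automorphism of order two), and let $S$ be a finite multi-subset of $G$ (for instance a subset), $|S|$ being counted with multiplicity. Consider the four graphs with vertex set $G$ that have, for each $x\in G$ and each $s\in S$ (with multiplicity), one edge from $x$ to $y$, where - $y=xs$ for the Cayley graph $C(G,S)$, - $y=x^{-1}s$ for the Cayley sum graph $C_\Sigma(G,S)$, - $y=\sigma(xs)$ for the twisted Cayley graph $C(G,S)^\sigma$, - $y=\sigma(x^{-1}s)$ for the twisted Cayley sum graph $C_\Sigma(G,S)^\sigma$. Such a graph is called undirected if for all $x,y$ the number of edges from $x$ to $y$ equals the number of edges from $y$ to $x$. For $\varepsilon>0$, a graph with finite vertex set $V$ is an $\varepsilon$-vertex expander if every $A\subseteq V$ with $|A|\le |V|/2$ has at least $\varepsilon|A|$ neighbours outside $A$. A connected undirected $m$-regular graph is a two-sided spectral $\varepsilon$-expander if all nontrivial eigenvalues of its normalised adjacency operator $\frac1m A$ lie in $(-1+\varepsilon,\,1-\varepsilon)$; the trivial eigenvalues are $1$ and, if the graph is bipartite,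 $-1$. Theorem. For every integer $d\ge 0$ and every $\varepsilon>0$ there is a $\delta>0$, depending only on $d$ and $\varepsilon$, such that the following holds for all $G,\sigma,S$ as above with $|S|\le d$. Let $X,Y$ be two (possibly equal) graphs among $C(G,S)$, $C_\Sigma(G,S)$, $C(G,S)^\sigma$, $C_\Sigma(G,S)^\sigma$, both undirected and connected. If $X,Y$ are $C_\Sigma(G,S)$ and $C(G,S)^\sigma$ in some order, assume moreover that $S$ is symmetric, i.e. $S=S^{-1}$ as multisets. If one of $X,Y$ is an $\varepsilon$-vertex expander or a two-sided spectral $\varepsilon$-expander, then the other is both a $\delta$-vertex expander and a two-sided spectral $\delta$-expander. -/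

import Mathlib

/-- A multigraph on the vertex set `V`, loops and multiple edges allowed: `Γ x y` is the number
of edges from `x` to `y`. -/
abbrev EdgeCount (V : Type*) := V → V → ℕ

namespace EdgeCount

variable {V : Type*}

/-- Every edge can be reversed, with multiplicity: the adjacency matrix is symmetric. -/
def Undirected (Γ : EdgeCount V) : Prop := ∀ x y, Γ x y = Γ y x

/-- `x` and `y` are joined by at least one edge from `x` to `y`. -/
def Adj (Γ : EdgeCount V) (x y : V) : Prop := 0 < Γ x y

/-- Any two vertices are joined by a path (used for undirected graphs). -/
def Connected (Γ : EdgeCount V) : Prop :=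
  Nonempty V ∧ ∀ x y, Relation.ReflTransGen Γ.Adj x y

/-- The vertices outside `A` that are adjacent to some vertex of `A`. -/
def outerBoundary (Γ : EdgeCount V) (A : Set V) : Set V :=
  {y | y ∉ A ∧ ∃ x ∈ A, Γ.Adj x y}

/-- `ε`-vertex expander: every set `A` of at most half of the vertices has at least `ε |A|`
neighbours outside `A`. -/
def IsVertexExpander (Γ : EdgeCount V) (ε : ℝ) : Prop :=
  ∀ A : Set V, 2 * A.ncard ≤ Nat.card V → ε * (A.ncard : ℝ) ≤ ((Γ.outerBoundary A).ncard : ℝ)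

/-- The normalised adjacency matrix `d⁻¹ A` of a `d`-regular graph. -/
noncomputable def normalizedAdjMatrix (Γ : EdgeCount V) (d : ℕ) : Matrix V V ℝ :=
  Matrix.of fun x y => (Γ x y : ℝ) / (d : ℝ)

/-- Two-sided spectral `ε`-expander, for a connected undirected `d`-regular graph: all nontrivial
eigenvalues of the normalised adjacency matrix lie in `(-1 + ε, 1 - ε)`. The trivial eigenvalues
are `1`, with the constant functions as its eigenvectors, and `-1` (which occurs for a connected
graph exactly when it is bipartite). As the matrix is symmetric with constant row sums, the
eigenvalues other than the one of the constants are those with an eigenvector orthogonal to the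
constants. -/
def IsTwoSidedSpectralExpander [Fintype V] (Γ : EdgeCount V) (d : ℕ) (ε : ℝ) : Prop :=
  ∀ (μ : ℝ) (f : V → ℝ), f ≠ 0 → ∑ v, f v = 0 → (Γ.normalizedAdjMatrix d).mulVec f = μ • f →
    μ ≠ -1 → -1 + ε < μ ∧ μ < 1 - ε

end EdgeCount

/-- The four constructions of a graph from a group, an automorphism and a connection set. -/
inductive CayleyKind where
  | cayley
  | cayleySum
  | twistedCayley
  | twistedCayleySum

namespace CayleyKind

variable {G : Type*} [Group G]

/-- The endpoint of the edge that starts at `x` and is labelled by `s`. -/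
def step (σ : G ≃* G) : CayleyKind → G → G → G
  | cayley, x, s => x * s
  | cayleySum, x, s => x⁻¹ * s
  | twistedCayley, x, s => σ (x * s)
  | twistedCayleySum, x, s => σ (x⁻¹ * s)

open Classical in
/-- The graph on `G` with one edge from `x` to `step x s` for every `s` in the multiset `S`,
counted with multiplicity. -/
noncomputable def graph (k : CayleyKind) (σ : G ≃* G) (S : Multiset G) : EdgeCount G :=
  fun x y => (S.filter fun s => y = k.step σ x s).card

end CayleyKind

/-! The four adjacency operators differ only by permutations of the domain (by `σ`) and of the
codomain (by inversion), so they have the same singular values. Undirected graphs have symmetric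
operators, so their eigenvalues agree up to sign, and a two-sided spectral gap passes from one graph
to another (`isTwoSidedSpectralExpander_transfer`).

It remains to derive a two-sided gap from vertex expansion. Cheeger's inequality keeps the
nontrivial spectrum away from `1`. Suppose an eigenvalue `μ` is much closer to `-1` than this gap.
The modulus of an eigenfunction then nearly maximises the quadratic form, so it is nearly constant
(`sq_sum_abs_ge_of_gap`), and a space of such functions is at most a line. Left translations
preserve the eigenspace (`comp_eq_comp_of_gap`), hence act on it by signs, and the eigenfunction `f`
takes only the values `± f 1`. The eigenvalue equation at the identity now makes `(μ + 1) * |S|` an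
even natural number. For bounded `|S|` and `μ` close enough to `-1` it is below `2`, so `μ = -1`,
which is trivial.

The easy half of Cheeger's inequality leads back to vertex expansion. -/

open Matrix Finset

/-! ### Spectral gap and Cheeger's inequality for symmetric stochastic matrices -/

section StochasticMatrix

variable {V : Type*} [Fintype V]

theorem sum_mulVec_eq_sum {M : Matrix V V ℝ} (hM : M.IsSymm) (hrow : ∀ x, ∑ y, M x y = 1)
    (f : V → ℝ) : ∑ x, (M *ᵥ f) x = ∑ x, f x := by
  simp only [mulVec, dotProduct]
  rw [Finset.sum_comm]
  refine Finset.sum_congr rfl fun y _ => ?_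
  rw [← Finset.sum_mul]
  have : ∑ x, M x y = 1 := by
    rw [← hrow y]
    exact Finset.sum_congr rfl fun x _ => hM.apply y x
  rw [this, one_mul]

theorem mulVec_const {M : Matrix V V ℝ} (hrow : ∀ x, ∑ y, M x y = 1) (c : ℝ) :
    M *ᵥ (fun _ => c) = fun _ => c := by
  ext x
  simp only [mulVec, dotProduct]
  rw [← Finset.sum_mul, hrow, one_mul]

theorem dotProduct_mulVec_comm_of_isSymm {M : Matrix V V ℝ} (hM : M.IsSymm) (f g : V → ℝ) :
    f ⬝ᵥ M *ᵥ g = g ⬝ᵥ M *ᵥ f := by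
  rw [dotProduct_mulVec, ← mulVec_transpose, hM.eq, dotProduct_comm]

/-- Variational principle on the functions with sum zero. -/
theorem dotProduct_mulVec_le_of_eigenvalue_le {M : Matrix V V ℝ} (hM : M.IsSymm)
    (hrow : ∀ x, ∑ y, M x y = 1) {c : ℝ} (hc : 0 ≤ c)
    (h : ∀ (μ : ℝ) (f : V → ℝ), f ≠ 0 → ∑ v, f v = 0 → M *ᵥ f = μ • f → μ ≤ c)
    (f : V → ℝ) (hf : ∑ v, f v = 0) : f ⬝ᵥ M *ᵥ f ≤ c * (f ⬝ᵥ f) := by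
  classical
  -- The all-ones matrix vanishes on functions with sum zero and makes the form nonnegative on
  -- constants, so the claim becomes positive semidefiniteness of `N`.
  let N : Matrix V V ℝ := c • (1 : Matrix V V ℝ) - M + Matrix.of fun _ _ => (1 : ℝ)
  have hN : N.IsHermitian := by
    ext x y
    simp only [N, conjTranspose_apply, Matrix.add_apply, Matrix.sub_apply, Matrix.smul_apply,
      of_apply, star_trivial, hM.apply, Matrix.one_apply, eq_comm]
  have hNv : ∀ v : V → ℝ, N *ᵥ v = c • v - M *ᵥ v + fun _ => ∑ x, v x := by
    intro v
    have : (Matrix.of fun _ _ => (1 : ℝ) : Matrix V V ℝ) *ᵥ v = fun _ => ∑ x, v x := by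
      ext x
      simp [mulVec, dotProduct]
    simp only [N, add_mulVec, sub_mulVec, smul_mulVec, one_mulVec, this]
  have hpos : N.PosSemidef := by
    rw [hN.posSemidef_iff_eigenvalues_nonneg]
    intro i
    have hev := hN.mulVec_eigenvectorBasis i
    set v : V → ℝ := ⇑(hN.eigenvectorBasis i) with hv
    set e := hN.eigenvalues i
    have hv0 : v ≠ 0 := by
      intro h0
      have h1 : hN.eigenvectorBasis i = 0 := by
        ext x
        exact congrFun h0 x
      have := hN.eigenvectorBasis.orthonormal.norm_eq_one i
      rw [h1] at this
      simp at this
    by_contra hneg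
    have he : e < 0 := by simpa using hneg
    rw [hNv] at hev
    have hsum : ∑ x, v x = 0 := by
      have h1 := congrArg (fun u : V → ℝ => ∑ x, u x) hev
      simp only [Pi.add_apply, Pi.sub_apply, Pi.smul_apply, smul_eq_mul, Finset.sum_add_distrib,
        Finset.sum_sub_distrib, sum_mulVec_eq_sum hM hrow, ← Finset.mul_sum, Finset.sum_const,
        Finset.card_univ, nsmul_eq_mul] at h1
      have hn : (1 : ℝ) ≤ Fintype.card V := by
        have : Nonempty V := ⟨i⟩
        exact_mod_cast Fintype.card_pos
      -- The first factor is positive if `e < 0`, so an eigenvector for a negative eigenvalue has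
      -- sum zero.
      have h2 : (c - 1 + Fintype.card V - e) * ∑ x, v x = 0 := by linear_combination h1
      rcases mul_eq_zero.1 h2 with h3 | h3
      · linarith
      · exact h3
    have := h (c - e) v hv0 hsum (by
      ext x
      have := congrFun hev x
      simp only [Pi.add_apply, Pi.sub_apply, Pi.smul_apply, smul_eq_mul, hsum] at this ⊢
      linear_combination -this)
    linarith
  have := hpos.dotProduct_mulVec_nonneg f
  rw [star_trivial, hNv, hf] at this
  have h0 : (fun _ : V => (0 : ℝ)) = 0 := rfl
  rw [h0, add_zero, dotProduct_sub, dotProduct_smul, smul_eq_mul] at this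
  linarith

/-- Co-area inequality. -/
theorem coarea_le {M : Matrix V V ℝ} [DecidableEq V] {κ : ℝ} {n : ℕ}
    (hA : ∀ A : Finset V, A.card ≤ n → κ * A.card ≤ ∑ x ∈ A, ∑ y ∈ Aᶜ, M x y)
    (F : V → ℝ) (hF : ∀ x, 0 ≤ F x) (hs : (univ.filter fun x => F x ≠ 0).card ≤ n) :
    κ * ∑ x, F x ≤ ∑ x, ∑ y, M x y * max (F x - F y) 0 := by
  induction hk : (univ.filter fun x => F x ≠ 0).card using Nat.strong_induction_on
    generalizing F with
  | _ k ih =>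
    set A := univ.filter fun x => F x ≠ 0 with hAdef
    have memA : ∀ x, x ∈ A ↔ F x ≠ 0 := fun x => by simp [hAdef]
    rcases A.eq_empty_or_nonempty with he | hne
    · have h0 : ∀ x, F x = 0 := by
        intro x
        by_contra hx
        have := (memA x).2 hx
        simp [he] at this
      simp [h0]
    · obtain ⟨a, haA, hamin⟩ := A.exists_min_image F hne
      set c := F a with hc
      have hc0 : 0 < c := lt_of_le_of_ne (hF a) (Ne.symm ((memA a).1 haA))
      -- Peel off the lowest level: lowering `F` by its least positive value `c` shrinks the support
      -- and costs `c` times the cut of `A`.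
      set F' : V → ℝ := fun x => if x ∈ A then F x - c else 0 with hF'
      have hFA : ∀ x, x ∉ A → F x = 0 := fun x hx => by
        by_contra h
        exact hx ((memA x).2 h)
      have hsub : (univ.filter fun x => F' x ≠ 0) ⊂ A := by
        refine ⟨fun x hx => ?_, fun hle => ?_⟩
        · by_contra hxA
          simp [hF', hxA] at hx
        · have := hle haA
          simp [hF', hc] at this
      have hlt := Finset.card_lt_card hsub
      have hF'0 : ∀ x, 0 ≤ F' x := by
        intro x
        by_cases hx : x ∈ A
        · simp only [hF', hx, if_true]
          linarith [hamin x hx]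
        · simp [hF', hx]
      have h1 := ih _ (hk ▸ hlt) F' hF'0 (hlt.le.trans hs) rfl
      have h2 := hA A hs
      have key : ∀ x y, M x y * max (F x - F y) 0 = M x y * max (F' x - F' y) 0 +
          c * (if x ∈ A then (if y ∈ Aᶜ then M x y else 0) else 0) := by
        intro x y
        by_cases hx : x ∈ A <;> by_cases hy : y ∈ A
        · simp [hF', hx, hy]
        · have : c ≤ F x := hamin x hx
          simp only [hF', hx, hy, if_true, if_false, hFA y hy, mem_compl, not_false_eq_true,
            sub_zero]
          rw [max_eq_left (hF x), max_eq_left (by linarith)]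
          ring
        · have : c ≤ F y := hamin y hy
          simp only [hF', hx, hy, if_true, if_false, hFA x hx]
          rw [max_eq_right (by linarith), max_eq_right (by linarith)]
          ring
        · simp [hF', hx, hy, hFA x hx, hFA y hy]
      have hsumF : ∑ x, F x = ∑ x, F' x + c * A.card := by
        have : ∀ x, F x = F' x + if x ∈ A then c else 0 := by
          intro x
          by_cases hx : x ∈ A
          · simp [hF', hx]
          · simp [hF', hx, hFA x hx]
        rw [Finset.sum_congr rfl fun x _ => this x, Finset.sum_add_distrib]
        simp [mul_comm]
      have hsumM : ∑ x, ∑ y, M x y * max (F x - F y) 0 =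
          ∑ x, ∑ y, M x y * max (F' x - F' y) 0 + c * ∑ x ∈ A, ∑ y ∈ Aᶜ, M x y := by
        simp only [key, Finset.sum_add_distrib, ← Finset.mul_sum]
        congr 2
        rw [← Finset.sum_filter_add_sum_filter_not univ (fun x => x ∈ A)]
        rw [Finset.sum_eq_zero (s := univ.filter fun x => x ∉ A)]
        · rw [add_zero, Finset.filter_univ_mem]
          refine Finset.sum_congr rfl fun x hx => ?_
          simp only [hx, if_true]
          rw [← Finset.sum_filter, Finset.filter_univ_mem]
        · intro x hx
          simp [(Finset.mem_filter.1 hx).2]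
      rw [hsumF, hsumM]
      nlinarith [mul_le_mul_of_nonneg_left h2 hc0.le]

theorem sum_sum_mul_sub_sq {M : Matrix V V ℝ} (hM : M.IsSymm) (hrow : ∀ x, ∑ y, M x y = 1)
    (g : V → ℝ) :
    ∑ x, ∑ y, M x y * (g x - g y) ^ 2 = 2 * (g ⬝ᵥ g - g ⬝ᵥ M *ᵥ g) := by
  have h1 : ∑ x, ∑ y, M x y * g x ^ 2 = g ⬝ᵥ g := by
    simp only [← Finset.sum_mul, hrow, one_mul, dotProduct, sq]
  have h2 : ∑ x, ∑ y, M x y * g y ^ 2 = g ⬝ᵥ g := by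
    rw [← h1, Finset.sum_comm]
    exact Finset.sum_congr rfl fun x _ => Finset.sum_congr rfl fun y _ => by rw [hM.apply]
  have h3 : ∑ x, ∑ y, M x y * (g x * g y) = g ⬝ᵥ M *ᵥ g := by
    simp only [dotProduct, mulVec, Finset.mul_sum]
    exact Finset.sum_congr rfl fun x _ => Finset.sum_congr rfl fun y _ => by ring
  have : ∀ x y, M x y * (g x - g y) ^ 2 =
      M x y * g x ^ 2 + M x y * g y ^ 2 - 2 * (M x y * (g x * g y)) := fun x y => by ring
  simp only [this, Finset.sum_sub_distrib, Finset.sum_add_distrib, ← Finset.mul_sum, h1, h2, h3]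
  ring

/-- The hard half of Cheeger's inequality, for an eigenvector with small positive support. -/
theorem cheeger_of_card_pos_le {M : Matrix V V ℝ} [DecidableEq V] (hM : M.IsSymm)
    (hrow : ∀ x, ∑ y, M x y = 1) (hnn : ∀ x y, 0 ≤ M x y) {κ : ℝ} (hκ : 0 ≤ κ) {n : ℕ}
    (hA : ∀ A : Finset V, A.card ≤ n → κ * A.card ≤ ∑ x ∈ A, ∑ y ∈ Aᶜ, M x y)
    {μ : ℝ} {f : V → ℝ} (hpos : ∃ x, 0 < f x) (hcard : (univ.filter fun x => 0 < f x).card ≤ n)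
    (hev : M *ᵥ f = μ • f) : μ ≤ 1 - κ ^ 2 / 2 := by
  set g : V → ℝ := fun x => max (f x) 0 with hg
  have hg0 : ∀ x, 0 ≤ g x := fun x => le_max_right _ _
  have hgg : 0 < g ⬝ᵥ g := by
    obtain ⟨x, hx⟩ := hpos
    refine Finset.sum_pos' (fun y _ => mul_self_nonneg _) ⟨x, mem_univ _, ?_⟩
    have : 0 < g x := lt_max_of_lt_left hx
    positivity
  -- Since `M` has nonnegative entries, truncating `f` to its positive part does not lower the
  -- Rayleigh quotient.
  have hray : μ * (g ⬝ᵥ g) ≤ g ⬝ᵥ M *ᵥ g := by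
    rw [dotProduct, dotProduct, Finset.mul_sum]
    refine Finset.sum_le_sum fun x _ => ?_
    rcases le_or_gt (f x) 0 with hx | hx
    · have : g x = 0 := max_eq_right hx
      simp [this]
    · have hgx : g x = f x := max_eq_left hx.le
      have h1 : μ * f x = (M *ᵥ f) x := by rw [hev]; rfl
      have h2 : (M *ᵥ f) x ≤ (M *ᵥ g) x :=
        Finset.sum_le_sum fun y _ => mul_le_mul_of_nonneg_left (le_max_left _ _) (hnn x y)
      rw [hgx]
      nlinarith
  have hco := coarea_le hA (fun x => g x ^ 2) (fun x => sq_nonneg _) (by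
    refine le_trans (Finset.card_le_card fun x hx => ?_) hcard
    simp only [Finset.mem_filter, mem_univ, true_and] at hx ⊢
    by_contra hle
    exact hx (by simp [hg, max_eq_right (not_lt.1 hle)]))
  have hsq : ∑ x, g x ^ 2 = g ⬝ᵥ g := by simp [dotProduct, sq]
  rw [hsq] at hco
  have habs : 2 * ∑ x, ∑ y, M x y * max (g x ^ 2 - g y ^ 2) 0 =
      ∑ x, ∑ y, M x y * (|g x - g y| * (g x + g y)) := by
    have hsw : ∑ x, ∑ y, M x y * max (g x ^ 2 - g y ^ 2) 0 =
        ∑ x, ∑ y, M x y * max (g y ^ 2 - g x ^ 2) 0 := by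
      rw [Finset.sum_comm]
      exact Finset.sum_congr rfl fun x _ => Finset.sum_congr rfl fun y _ => by rw [hM.apply]
    rw [two_mul]
    nth_rewrite 2 [hsw]
    simp only [← Finset.sum_add_distrib, ← mul_add]
    refine Finset.sum_congr rfl fun x _ => Finset.sum_congr rfl fun y _ => ?_
    congr 1
    rcases le_total (g x) (g y) with h | h
    · rw [max_eq_right (by nlinarith [hg0 x]), max_eq_left (by nlinarith [hg0 x]),
        abs_of_nonpos (by linarith)]
      ring
    · rw [max_eq_left (by nlinarith [hg0 y]), max_eq_right (by nlinarith [hg0 y]),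
        abs_of_nonneg (by linarith)]
      ring
  have hD := sum_sum_mul_sub_sq hM hrow g
  have hP : ∑ x, ∑ y, M x y * (g x + g y) ^ 2 ≤ 4 * (g ⬝ᵥ g) := by
    have h0 : 0 ≤ ∑ x, ∑ y, M x y * (g x - g y) ^ 2 :=
      Finset.sum_nonneg fun x _ => Finset.sum_nonneg fun y _ => mul_nonneg (hnn x y) (sq_nonneg _)
    have h1 : ∑ x, ∑ y, M x y * (g x + g y) ^ 2 = 2 * (g ⬝ᵥ g + g ⬝ᵥ M *ᵥ g) := by
      have h3 : ∑ x, ∑ y, M x y * (g x * g y) = g ⬝ᵥ M *ᵥ g := by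
        simp only [dotProduct, mulVec, Finset.mul_sum]
        exact Finset.sum_congr rfl fun x _ => Finset.sum_congr rfl fun y _ => by ring
      have : ∀ x y, M x y * (g x + g y) ^ 2 =
        M x y * (g x - g y) ^ 2 + 4 * (M x y * (g x * g y)) := fun x y => by ring
      simp only [this, Finset.sum_add_distrib, ← Finset.mul_sum, h3, hD]
      ring
    linarith
  -- Cauchy–Schwarz with weights `M x y`, after factoring the difference of squares from the co-area
  -- inequality.
  have hCS : (∑ x, ∑ y, M x y * (|g x - g y| * (g x + g y))) ^ 2 ≤
      (∑ x, ∑ y, M x y * (g x - g y) ^ 2) * ∑ x, ∑ y, M x y * (g x + g y) ^ 2 := by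
    simp only [← Fintype.sum_prod_type']
    refine Finset.sum_sq_le_sum_mul_sum_of_sq_le_mul _ (fun p _ => mul_nonneg (hnn _ _) (sq_nonneg _))
      (fun p _ => mul_nonneg (hnn _ _) (sq_nonneg _)) fun p _ => le_of_eq ?_
    rw [mul_pow, mul_pow, sq_abs]
    ring
  have hD2 : ∑ x, ∑ y, M x y * (g x - g y) ^ 2 ≤ 2 * (1 - μ) * (g ⬝ᵥ g) := by
    rw [hD]; linarith
  have hlow : 2 * (κ * (g ⬝ᵥ g)) ≤ ∑ x, ∑ y, M x y * (|g x - g y| * (g x + g y)) := by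
    rw [← habs]; linarith
  have hP0 : 0 ≤ ∑ x, ∑ y, M x y * (g x + g y) ^ 2 :=
    Finset.sum_nonneg fun x _ => Finset.sum_nonneg fun y _ => mul_nonneg (hnn x y) (sq_nonneg _)
  have hD0 : 0 ≤ ∑ x, ∑ y, M x y * (g x - g y) ^ 2 :=
    Finset.sum_nonneg fun x _ => Finset.sum_nonneg fun y _ => mul_nonneg (hnn x y) (sq_nonneg _)
  have h4 : (2 * (κ * (g ⬝ᵥ g))) ^ 2 ≤ (2 * (1 - μ) * (g ⬝ᵥ g)) * (4 * (g ⬝ᵥ g)) :=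
    (pow_le_pow_left₀ (by positivity) hlow 2).trans
      (hCS.trans (mul_le_mul hD2 hP hP0 (hD0.trans hD2)))
  have h5 : 0 < (g ⬝ᵥ g) ^ 2 := by positivity
  by_contra hcon
  nlinarith

/-- The hard half of Cheeger's inequality. -/
theorem cheeger {M : Matrix V V ℝ} [DecidableEq V] (hM : M.IsSymm)
    (hrow : ∀ x, ∑ y, M x y = 1) (hnn : ∀ x y, 0 ≤ M x y) {κ : ℝ} (hκ : 0 ≤ κ)
    (hA : ∀ A : Finset V, 2 * A.card ≤ Fintype.card V →
      κ * A.card ≤ ∑ x ∈ A, ∑ y ∈ Aᶜ, M x y)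
    {μ : ℝ} {f : V → ℝ} (hf0 : f ≠ 0) (hf : ∑ v, f v = 0)
    (hev : M *ᵥ f = μ • f) : μ ≤ 1 - κ ^ 2 / 2 := by
  have hA' : ∀ A : Finset V, A.card ≤ Fintype.card V / 2 →
      κ * A.card ≤ ∑ x ∈ A, ∑ y ∈ Aᶜ, M x y := fun A h => hA A (by omega)
  have hpos : ∀ f : V → ℝ, f ≠ 0 → ∑ v, f v = 0 → ∃ x, 0 < f x := by
    intro f hf0 hf
    by_contra! hle
    refine hf0 (funext fun x => ?_)
    exact (Finset.sum_eq_zero_iff_of_nonpos fun y _ => hle y).1 hf x (mem_univ x)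
  have hdisj : (univ.filter fun x => 0 < f x).card + (univ.filter fun x => 0 < (-f) x).card ≤
      Fintype.card V := by
    rw [← Finset.card_union_of_disjoint]
    · exact Finset.card_le_univ _
    · rw [Finset.disjoint_filter]
      intro x _ h1 h2
      simp only [Pi.neg_apply] at h2
      linarith
  rcases le_total (univ.filter fun x => 0 < f x).card (univ.filter fun x => 0 < (-f) x).card
    with h | h
  · exact cheeger_of_card_pos_le hM hrow hnn hκ hA' (hpos f hf0 hf) (by omega) hev
  · refine cheeger_of_card_pos_le hM hrow hnn hκ hA' (f := -f)
      (hpos _ (neg_ne_zero.2 hf0) (by simp [hf])) (by omega) ?_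
    rw [mulVec_neg, hev, smul_neg]

/-- The easy half of Cheeger's inequality. -/
theorem conductance_of_gap {M : Matrix V V ℝ} [DecidableEq V] (hM : M.IsSymm)
    (hrow : ∀ x, ∑ y, M x y = 1) {η : ℝ} (hη : 0 ≤ η)
    (hgap : ∀ f : V → ℝ, ∑ v, f v = 0 → f ⬝ᵥ M *ᵥ f ≤ (1 - η) * (f ⬝ᵥ f))
    (A : Finset V) (hA : 2 * A.card ≤ Fintype.card V) :
    η / 2 * A.card ≤ ∑ x ∈ A, ∑ y ∈ Aᶜ, M x y := by
  rcases A.eq_empty_or_nonempty with rfl | hne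
  · simp
  have hn : 0 < (Fintype.card V : ℝ) := by
    obtain ⟨x, _⟩ := hne
    have : Nonempty V := ⟨x⟩
    exact_mod_cast Fintype.card_pos
  set p : ℝ := A.card / Fintype.card V with hp
  have hpn : p * Fintype.card V = A.card := by rw [hp]; field_simp
  have hp2 : p ≤ 1 / 2 := by
    rw [hp, div_le_iff₀ hn]
    have : (2 * A.card : ℝ) ≤ Fintype.card V := by exact_mod_cast hA
    linarith
  have hAc : (0 : ℝ) ≤ A.card := by positivity
  set u : V → ℝ := fun x => if x ∈ A then 1 else 0 with hu
  -- The test function is the centred indicator of `A`: the cut is at least `η * |A| * (1 - p)`, and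
  -- `p ≤ 1/2`.
  set f : V → ℝ := u - fun _ => p with hf
  have hu1 : ∑ x, u x = A.card := by simp [hu]
  have huu : u ⬝ᵥ u = A.card := by simp [hu, dotProduct]
  have huMu : u ⬝ᵥ M *ᵥ u = A.card - ∑ x ∈ A, ∑ y ∈ Aᶜ, M x y := by
    have h1 : u ⬝ᵥ M *ᵥ u = ∑ x ∈ A, ∑ y ∈ A, M x y := by
      simp [hu, dotProduct, mulVec]
    have h2 : ∑ x ∈ A, (∑ y ∈ A, M x y + ∑ y ∈ Aᶜ, M x y) = A.card := by
      simp [Finset.sum_add_sum_compl, hrow]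
    rw [Finset.sum_add_distrib] at h2
    linarith
  have hc1 : ∀ w : V → ℝ, (fun _ : V => p) ⬝ᵥ w = p * ∑ x, w x := fun w => by
    simp [dotProduct, Finset.mul_sum]
  have hf0 : ∑ x, f x = 0 := by
    simp only [hf, Pi.sub_apply, Finset.sum_sub_distrib, hu1, Finset.sum_const, card_univ,
      nsmul_eq_mul]
    linarith
  have hff : f ⬝ᵥ f = A.card - p * A.card := by
    rw [hf, sub_dotProduct, dotProduct_sub, dotProduct_comm u fun _ => p, hc1, hc1, huu, hu1]
    have : ∑ x, (u - fun _ => p : V → ℝ) x = 0 := hf0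
    rw [this]
    ring
  have hfM : f ⬝ᵥ M *ᵥ f = A.card - ∑ x ∈ A, ∑ y ∈ Aᶜ, M x y - p * A.card := by
    have h1 : ∑ x, (M *ᵥ f) x = 0 := by rw [sum_mulVec_eq_sum hM hrow, hf0]
    have h2 : f ⬝ᵥ M *ᵥ f = u ⬝ᵥ M *ᵥ f := by
      conv_lhs => rw [hf, sub_dotProduct, hc1]
      rw [← hf, h1]
      ring
    rw [h2, hf, mulVec_sub, mulVec_const hrow, dotProduct_sub, huMu, dotProduct_comm u fun _ => p, hc1, hu1]
  have := hgap f hf0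
  rw [hff, hfM] at this
  nlinarith [mul_nonneg hη hAc, mul_nonneg (mul_nonneg hη hAc) (sub_nonneg.2 hp2)]

/-! ### Eigenvalues near `-1` -/

/-- If all eigenvalues but the trivial one are at most `1 - η`, the modulus of an eigenfunction for
an eigenvalue near `-1` is nearly constant. -/
theorem sq_sum_abs_ge_of_gap {M : Matrix V V ℝ} (hM : M.IsSymm)
    (hrow : ∀ x, ∑ y, M x y = 1) (hnn : ∀ x y, 0 ≤ M x y) {η t : ℝ} (hη : 0 < η)
    (hgap : ∀ f : V → ℝ, ∑ v, f v = 0 → f ⬝ᵥ M *ᵥ f ≤ (1 - η) * (f ⬝ᵥ f))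
    {μ : ℝ} (hμ : μ ≤ -1 + t * η) {f : V → ℝ} (hev : M *ᵥ f = μ • f) :
    (1 - t) * (f ⬝ᵥ f) * Fintype.card V ≤ (∑ x, |f x|) ^ 2 := by
  rcases isEmpty_or_nonempty V with hV | hV
  · simp [dotProduct]
  have hn : 0 < (Fintype.card V : ℝ) := by exact_mod_cast Fintype.card_pos
  set a : V → ℝ := fun x => |f x| with ha
  set c : ℝ := (∑ x, a x) / Fintype.card V with hc
  have hcn : c * Fintype.card V = ∑ x, a x := by rw [hc]; field_simp
  set h : V → ℝ := a - fun _ => c with hh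
  have haa : a ⬝ᵥ a = f ⬝ᵥ f := by simp [ha, dotProduct]
  have hff : 0 ≤ f ⬝ᵥ f := Finset.sum_nonneg fun x _ => mul_self_nonneg _
  -- The form at `|f|` is almost `f ⬝ᵥ f`. By the gap, it loses at least `η * (h ⬝ᵥ h)`, so the
  -- deviation `h` of `|f|` from its mean is small.
  have hlow : -μ * (f ⬝ᵥ f) ≤ a ⬝ᵥ M *ᵥ a := by
    have h1 : f ⬝ᵥ M *ᵥ f = μ * (f ⬝ᵥ f) := by rw [hev, dotProduct_smul, smul_eq_mul]
    have h2 : -(f ⬝ᵥ M *ᵥ f) ≤ a ⬝ᵥ M *ᵥ a := by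
      simp only [dotProduct, mulVec, Finset.mul_sum, ← Finset.sum_neg_distrib]
      refine Finset.sum_le_sum fun x _ => Finset.sum_le_sum fun y _ => ?_
      have h3 : -(f x * f y) ≤ |f x| * |f y| := by
        rw [← abs_mul]
        exact neg_le_abs _
      have := mul_le_mul_of_nonneg_left h3 (hnn x y)
      simp only [ha]
      linarith
    linarith
  have hc1 : ∀ w : V → ℝ, (fun _ : V => c) ⬝ᵥ w = c * ∑ x, w x := fun w => by
    simp [dotProduct, Finset.mul_sum]
  have hh0 : ∑ x, h x = 0 := by
    simp only [hh, Pi.sub_apply, Finset.sum_sub_distrib, Finset.sum_const, card_univ,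
      nsmul_eq_mul]
    linarith
  have hahc : a = h + fun _ => c := by simp [hh]
  have haa2 : a ⬝ᵥ a = h ⬝ᵥ h + c * (c * Fintype.card V) := by
    rw [hahc, add_dotProduct, dotProduct_add, dotProduct_comm h fun _ => c, hc1, hc1]
    have : ∑ x, (h + fun _ => c : V → ℝ) x = c * Fintype.card V := by rw [← hahc, hcn]
    rw [this, hh0]
    ring
  have haM : a ⬝ᵥ M *ᵥ a = h ⬝ᵥ M *ᵥ h + c * (c * Fintype.card V) := by
    rw [hahc, mulVec_add, mulVec_const hrow, add_dotProduct, dotProduct_add,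
      dotProduct_comm h fun _ => c, hc1, hc1, hh0]
    have : ∑ x, (M *ᵥ h + fun _ => c : V → ℝ) x = c * Fintype.card V := by
      simp only [Pi.add_apply, Finset.sum_add_distrib, sum_mulVec_eq_sum hM hrow, hh0,
        Finset.sum_const, card_univ, nsmul_eq_mul]
      ring
    rw [this]
    ring
  have hg := hgap h hh0
  have h1 : (1 - t * η) * (f ⬝ᵥ f) ≤ -μ * (f ⬝ᵥ f) :=
    mul_le_mul_of_nonneg_right (by linarith) hff
  have h2 : η * (h ⬝ᵥ h) ≤ η * (t * (f ⬝ᵥ f)) := by linarith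
  have h3 := le_of_mul_le_mul_left h2 hη
  have h4 : (1 - t) * (f ⬝ᵥ f) ≤ c * (c * Fintype.card V) := by linarith
  have h5 := mul_le_mul_of_nonneg_right h4 hn.le
  calc _ ≤ c * (c * Fintype.card V) * Fintype.card V := h5
    _ = (∑ x, |f x|) ^ 2 := by rw [show ∑ x, |f x| = ∑ x, a x from rfl, ← hcn]; ring

theorem abs_add_add_abs_sub_eq_two_mul_max (p q : ℝ) :
    |p + q| + |p - q| = 2 * max |p| |q| := by
  rw [max_def]
  split_ifs with h
  · rw [← sq_le_sq, ← sub_nonneg, sq_sub_sq] at h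
    rcases abs_cases (p + q) with ⟨e1, _⟩ | ⟨e1, _⟩ <;>
    rcases abs_cases (p - q) with ⟨e2, _⟩ | ⟨e2, _⟩ <;>
    rcases abs_cases q with ⟨e4, _⟩ | ⟨e4, _⟩ <;> rw [e1, e2, e4] <;> nlinarith
  · rw [not_le, ← sq_lt_sq, ← sub_pos, sq_sub_sq] at h
    rcases abs_cases (p + q) with ⟨e1, _⟩ | ⟨e1, _⟩ <;>
    rcases abs_cases (p - q) with ⟨e2, _⟩ | ⟨e2, _⟩ <;>
    rcases abs_cases p with ⟨e4, _⟩ | ⟨e4, _⟩ <;> rw [e1, e2, e4] <;> nlinarith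

/-- Here `a`, `b`, `p`, `q` are the `ℓ¹` norms of orthonormal functions and of their sum and
difference, `M` and `N` those of the pointwise maximum and minimum of the two moduli, and `r ^ 2` is
the number of points. Near-constancy of the sum and difference forces `M ≥ 1.4 r`, of the two
functions `N ≥ 0.48 r`, and the squares add up to more than `2 r ^ 2`. -/
theorem not_moduli_bounds {r a b p q M N : ℝ} (hr : 0 < r) (ha : 0 ≤ a) (hb : 0 ≤ b) (hp : 0 ≤ p)
    (hq : 0 ≤ q) (h1 : 99 / 100 * 1 * r ^ 2 ≤ a ^ 2) (h2 : 99 / 100 * 1 * r ^ 2 ≤ b ^ 2)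
    (h3 : 99 / 100 * 2 * r ^ 2 ≤ p ^ 2) (h4 : 99 / 100 * 2 * r ^ 2 ≤ q ^ 2)
    (hpq : p + q = 2 * M) (hab : M + N = a + b) (hMN : M ^ 2 + N ^ 2 ≤ 2 * r ^ 2) : False := by
  have q1 : 99 / 100 * r ≤ a := abs_le_of_sq_le_sq' (by nlinarith) ha |>.2
  have q2 : 99 / 100 * r ≤ b := abs_le_of_sq_le_sq' (by nlinarith) hb |>.2
  have q3 : 7 / 5 * r ≤ p := abs_le_of_sq_le_sq' (by nlinarith) hp |>.2
  have q4 : 7 / 5 * r ≤ q := abs_le_of_sq_le_sq' (by nlinarith) hq |>.2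
  have q5 : M ≤ 3 / 2 * r := abs_le_of_sq_le_sq' (by nlinarith [sq_nonneg N]) (by positivity) |>.2
  have q6 : 7 / 5 * r ≤ M := by linarith
  have q7 : 12 / 25 * r ≤ N := by linarith
  nlinarith [pow_le_pow_left₀ (by positivity) q6 2, pow_le_pow_left₀ (by positivity) q7 2]

/-- A space of functions whose moduli are all nearly constant has dimension at most one. -/
theorem eq_zero_of_dotProduct_eq_zero_of_abs_nearly_const (E : Submodule ℝ (V → ℝ))
    (hE : ∀ f ∈ E, 99 / 100 * (f ⬝ᵥ f) * Fintype.card V ≤ (∑ x, |f x|) ^ 2)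
    {f g : V → ℝ} (hf : f ∈ E) (hg : g ∈ E) (hf0 : f ≠ 0) (hfg : f ⬝ᵥ g = 0) : g = 0 := by
  by_contra hg0
  have hnorm : ∀ u : V → ℝ, u ≠ 0 → 0 < u ⬝ᵥ u := fun u hu =>
    lt_of_le_of_ne (Finset.sum_nonneg fun x _ => mul_self_nonneg _)
      (Ne.symm (mt dotProduct_self_eq_zero.1 hu))
  have hscale : ∀ u : V → ℝ, u ≠ 0 → (√(u ⬝ᵥ u))⁻¹ • u ⬝ᵥ (√(u ⬝ᵥ u))⁻¹ • u = 1 := by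
    intro u hu
    have := hnorm u hu
    rw [smul_dotProduct, dotProduct_smul, smul_eq_mul, smul_eq_mul, ← mul_assoc, ← mul_inv,
      Real.mul_self_sqrt this.le, inv_mul_cancel₀ this.ne']
  set a := (√(f ⬝ᵥ f))⁻¹ • f with ha
  set b := (√(g ⬝ᵥ g))⁻¹ • g with hb
  have haE : a ∈ E := E.smul_mem _ hf
  have hbE : b ∈ E := E.smul_mem _ hg
  have haa : a ⬝ᵥ a = 1 := hscale f hf0
  have hbb : b ⬝ᵥ b = 1 := hscale g hg0
  have hab : a ⬝ᵥ b = 0 := by rw [ha, hb, smul_dotProduct, dotProduct_smul, hfg]; simp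
  have hba : b ⬝ᵥ a = 0 := by rw [dotProduct_comm, hab]
  have hn : 0 < (Fintype.card V : ℝ) := by
    obtain ⟨x, _⟩ := Function.ne_iff.1 hf0
    have : Nonempty V := ⟨x⟩
    exact_mod_cast Fintype.card_pos
  have h1 := hE a haE
  have h2 := hE b hbE
  have h3 := hE (a + b) (E.add_mem haE hbE)
  have h4 := hE (a - b) (E.sub_mem haE hbE)
  have h5 : (a + b) ⬝ᵥ (a + b) = 2 := by
    rw [add_dotProduct, dotProduct_add, dotProduct_add, haa, hbb, hab, hba]; norm_num
  have h6 : (a - b) ⬝ᵥ (a - b) = 2 := by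
    rw [sub_dotProduct, dotProduct_sub, dotProduct_sub, haa, hbb, hab, hba]; norm_num
  rw [haa] at h1
  rw [hbb] at h2
  rw [h5] at h3
  rw [h6] at h4
  have hmax : ∑ x, |(a + b) x| + ∑ x, |(a - b) x| = 2 * ∑ x, max |a x| |b x| := by
    rw [← Finset.sum_add_distrib, Finset.mul_sum]
    refine Finset.sum_congr rfl fun x _ => ?_
    exact abs_add_add_abs_sub_eq_two_mul_max _ _
  have hmaxmin : ∑ x, max |a x| |b x| + ∑ x, min |a x| |b x| = ∑ x, |a x| + ∑ x, |b x| := by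
    rw [← Finset.sum_add_distrib, ← Finset.sum_add_distrib]
    exact Finset.sum_congr rfl fun x _ => max_add_min _ _
  have hsq : ∑ x, max |a x| |b x| ^ 2 + ∑ x, min |a x| |b x| ^ 2 = 2 := by
    have : ∑ x, |a x| ^ 2 + ∑ x, |b x| ^ 2 = 2 := by
      have h7 : ∑ x, |a x| ^ 2 = 1 := by rw [← haa]; simp [dotProduct, sq]
      have h8 : ∑ x, |b x| ^ 2 = 1 := by rw [← hbb]; simp [dotProduct, sq]
      rw [h7, h8]; norm_num
    rw [← this, ← Finset.sum_add_distrib, ← Finset.sum_add_distrib]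
    refine Finset.sum_congr rfl fun x _ => ?_
    rcases le_total |a x| |b x| with h | h
    · rw [max_eq_right h, min_eq_left h, add_comm]
    · rw [max_eq_left h, min_eq_right h]
  have hM := sq_sum_le_card_mul_sum_sq (s := univ) (f := fun x => max |a x| |b x|)
  have hN := sq_sum_le_card_mul_sum_sq (s := univ) (f := fun x => min |a x| |b x|)
  rw [card_univ] at hM hN
  have p1 : 0 ≤ ∑ x, |a x| := Finset.sum_nonneg fun x _ => abs_nonneg _
  have p2 : 0 ≤ ∑ x, |b x| := Finset.sum_nonneg fun x _ => abs_nonneg _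
  have p3 : 0 ≤ ∑ x, |(a + b) x| := Finset.sum_nonneg fun x _ => abs_nonneg _
  have p4 : 0 ≤ ∑ x, |(a - b) x| := Finset.sum_nonneg fun x _ => abs_nonneg _
  have hMN : (∑ x, max |a x| |b x|) ^ 2 + (∑ x, min |a x| |b x|) ^ 2 ≤
      2 * Fintype.card V := by
    calc _ ≤ _ := add_le_add hM hN
      _ = _ := by rw [← mul_add, hsq, mul_comm]
  obtain ⟨r, hr, hrn⟩ : ∃ r : ℝ, 0 < r ∧ r ^ 2 = Fintype.card V :=
    ⟨√(Fintype.card V), Real.sqrt_pos.2 hn, Real.sq_sqrt hn.le⟩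
  rw [← hrn] at h1 h2 h3 h4 hMN
  exact not_moduli_bounds hr p1 p2 p3 p4 h1 h2 h3 h4 hmax hmaxmin hMN

end StochasticMatrix

section StochasticMatrix

variable {V : Type*} [Fintype V]

/-- If permutations `α`, `β` intertwine `M`, an eigenfunction for an eigenvalue whose negative lies
in the spectral gap does not distinguish between them. -/
theorem comp_eq_comp_of_gap {M : Matrix V V ℝ} (hM : M.IsSymm) {η : ℝ}
    (hgap : ∀ f : V → ℝ, ∑ v, f v = 0 → f ⬝ᵥ M *ᵥ f ≤ (1 - η) * (f ⬝ᵥ f))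
    {μ : ℝ} (hμ : μ < -1 + η) {f : V → ℝ} (hev : M *ᵥ f = μ • f) (α β : Equiv.Perm V)
    (hαβ : ∀ x y, M (α x) (β y) = M x y) :
    f ∘ α = f ∘ β ∧ M *ᵥ (f ∘ α) = μ • (f ∘ α) := by
  have h1 : M *ᵥ (f ∘ β) = μ • (f ∘ α) := by
    ext x
    have := congrFun hev (α x)
    simp only [mulVec, dotProduct, Pi.smul_apply, Function.comp_apply] at this ⊢
    rw [← this, ← Equiv.sum_comp β fun y => M (α x) y * f y]
    exact Finset.sum_congr rfl fun y _ => by rw [hαβ]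
  have h2 : M *ᵥ (f ∘ α) = μ • (f ∘ β) := by
    ext y
    have := congrFun hev (β y)
    simp only [mulVec, dotProduct, Pi.smul_apply, Function.comp_apply] at this ⊢
    rw [← this, ← Equiv.sum_comp α fun x => M (β y) x * f x]
    refine Finset.sum_congr rfl fun x _ => ?_
    rw [← hM.apply (β y) (α x), hαβ, hM.apply]
  -- The difference satisfies the eigenvalue equation for `-μ > 1 - η` and has sum zero, so the gap
  -- annihilates it.
  have h3 : f ∘ α - f ∘ β = 0 := by
    have hs : ∑ v, (f ∘ α - f ∘ β) v = 0 := by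
      simp only [Pi.sub_apply, Function.comp_apply, Finset.sum_sub_distrib, Equiv.sum_comp, sub_self]
    have := hgap _ hs
    rw [mulVec_sub, h1, h2, ← smul_sub, ← neg_sub (f ∘ α) (f ∘ β), smul_neg, dotProduct_neg,
      dotProduct_smul, smul_eq_mul] at this
    have hnn : 0 ≤ (f ∘ α - f ∘ β) ⬝ᵥ (f ∘ α - f ∘ β) :=
      Finset.sum_nonneg fun x _ => mul_self_nonneg _
    refine dotProduct_self_eq_zero.1 ?_
    nlinarith
  have h4 := sub_eq_zero.1 h3
  exact ⟨h4, by rw [h2, h4]⟩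

end StochasticMatrix

/-! ### Vertex expansion and spectral expansion of regular graphs -/

namespace EdgeCount

variable {V : Type*} {Γ : EdgeCount V} {m : ℕ}

theorem Undirected.isSymm_normalizedAdjMatrix (hΓ : Γ.Undirected) (m : ℕ) :
    (Γ.normalizedAdjMatrix m).IsSymm := by
  ext x y
  simp [normalizedAdjMatrix, hΓ x y]

theorem normalizedAdjMatrix_nonneg (Γ : EdgeCount V) (m : ℕ) (x y : V) :
    0 ≤ Γ.normalizedAdjMatrix m x y := by
  simp only [normalizedAdjMatrix, of_apply]
  positivity

variable [Fintype V]

theorem IsTwoSidedSpectralExpander.mono {ε δ : ℝ} (h : Γ.IsTwoSidedSpectralExpander m ε)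
    (hδ : δ ≤ ε) : Γ.IsTwoSidedSpectralExpander m δ := fun μ f h0 hs hev hμ => by
  have := h μ f h0 hs hev hμ
  constructor <;> linarith

theorem sum_compl_normalizedAdjMatrix_eq [DecidableEq V] (Γ : EdgeCount V) (m : ℕ)
    (A : Finset V) [DecidablePred (· ∈ Γ.outerBoundary A)] :
    ∑ x ∈ A, ∑ y ∈ Aᶜ, Γ.normalizedAdjMatrix m x y =
      ∑ y with y ∈ Γ.outerBoundary A, ∑ x ∈ A, Γ.normalizedAdjMatrix m x y := by
  refine Finset.sum_comm.trans (Finset.sum_subset (s₁ := univ.filter (· ∈ Γ.outerBoundary A)) (s₂ := Aᶜ)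
    (f := fun y => ∑ x ∈ A, Γ.normalizedAdjMatrix m x y) (fun y hy => ?_) fun y hy hyB => ?_).symm
  · simpa using (Finset.mem_filter.1 hy).2.1
  · refine Finset.sum_eq_zero fun x hx => ?_
    have : Γ x y = 0 := by
      by_contra h
      refine hyB (Finset.mem_filter.2 ⟨mem_univ _, ?_, x, hx, Nat.pos_of_ne_zero h⟩)
      simpa using hy
    simp [normalizedAdjMatrix, this]

/-- Each boundary vertex receives at least one edge from `A`, of weight `1 / m`. -/
theorem card_outerBoundary_div_le [DecidableEq V] (Γ : EdgeCount V) (m : ℕ) (A : Finset V) :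
    ((Γ.outerBoundary A).ncard : ℝ) / m ≤ ∑ x ∈ A, ∑ y ∈ Aᶜ, Γ.normalizedAdjMatrix m x y := by
  classical
  have : (Γ.outerBoundary A).toFinset = univ.filter (· ∈ Γ.outerBoundary A) := by ext; simp
  rw [sum_compl_normalizedAdjMatrix_eq, Set.ncard_eq_toFinset_card', this, div_eq_mul_inv,
    ← nsmul_eq_mul]
  refine Finset.card_nsmul_le_sum _ _ _ fun y hy => ?_
  obtain ⟨-, x, hx, hxy⟩ := (Finset.mem_filter.1 hy).2
  refine le_trans ?_ (Finset.single_le_sum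
    (fun x _ => Γ.normalizedAdjMatrix_nonneg m x y) (Finset.mem_coe.1 hx))
  simp only [normalizedAdjMatrix, of_apply]
  rw [inv_eq_one_div]
  gcongr
  exact_mod_cast hxy

/-- By symmetry the columns also sum to `1`, so no boundary vertex receives more weight than that.
-/
theorem sum_compl_le_card_outerBoundary [DecidableEq V] (hΓ : Γ.Undirected)
    (hrow : ∀ x, ∑ y, Γ.normalizedAdjMatrix m x y = 1) (A : Finset V) :
    ∑ x ∈ A, ∑ y ∈ Aᶜ, Γ.normalizedAdjMatrix m x y ≤ (Γ.outerBoundary A).ncard := by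
  classical
  have : (Γ.outerBoundary A).toFinset = univ.filter (· ∈ Γ.outerBoundary A) := by ext; simp
  rw [sum_compl_normalizedAdjMatrix_eq, Set.ncard_eq_toFinset_card', this]
  refine (Finset.sum_le_card_nsmul _ _ 1 fun y _ => ?_).trans_eq (by simp)
  rw [← hrow y]
  simp only [fun x => ((hΓ.isSymm_normalizedAdjMatrix m).apply x y).symm]
  exact Finset.sum_le_sum_of_subset_of_nonneg (subset_univ _)
    fun x _ _ => Γ.normalizedAdjMatrix_nonneg m y x

/-- A harmonic function with sum zero on a connected graph vanishes. -/
theorem Connected.eq_zero_of_mulVec_eq_self (hΓ : Γ.Connected)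
    (hrow : ∀ x, ∑ y, Γ.normalizedAdjMatrix m x y = 1) {f : V → ℝ} (hf : ∑ v, f v = 0)
    (hev : Γ.normalizedAdjMatrix m *ᵥ f = f) : f = 0 := by
  obtain ⟨hne, hconn⟩ := hΓ
  obtain ⟨x₀, hx₀⟩ := Finite.exists_max f
  have hm : (m : ℝ) ≠ 0 := by
    intro h
    have := hrow x₀
    simp [normalizedAdjMatrix, h] at this
  have hall : ∀ y, f y = f x₀ := by
    -- Maximum principle: at a maximum the nonnegative numbers `f x₀ - f y` average to zero, so all
    -- neighbours are maxima too.
    intro y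
    induction hconn x₀ y with
    | refl => rfl
    | @tail b c _ hbc ih =>
      have h1 : ∑ y, Γ.normalizedAdjMatrix m b y * (f x₀ - f y) = 0 := by
        have := congrFun hev b
        simp only [mulVec, dotProduct] at this
        simp only [mul_sub, Finset.sum_sub_distrib, ← Finset.sum_mul, hrow, this, ih]
        ring
      have h2 := (Finset.sum_eq_zero_iff_of_nonneg fun y _ =>
        mul_nonneg (Γ.normalizedAdjMatrix_nonneg m b y) (sub_nonneg.2 (hx₀ y))).1 h1 c (mem_univ c)
      rcases mul_eq_zero.1 h2 with h3 | h3
      · have : Γ b c ≠ 0 := Nat.pos_iff_ne_zero.1 hbc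
        simp [normalizedAdjMatrix, hm, this] at h3
      · linarith
  have h0 : f x₀ = 0 := by
    have hn : (Fintype.card V : ℝ) ≠ 0 := by exact_mod_cast Fintype.card_ne_zero
    simpa [hall, hn] using hf
  ext y
  simp [hall y, h0]

theorem IsVertexExpander.eigenvalue_le (hΓ : Γ.Undirected)
    (hrow : ∀ x, ∑ y, Γ.normalizedAdjMatrix m x y = 1) {ε κ : ℝ} (hκ : 0 ≤ κ) (hκε : κ * m ≤ ε)
    (h : Γ.IsVertexExpander ε) {μ : ℝ} {f : V → ℝ} (hf0 : f ≠ 0) (hf : ∑ v, f v = 0)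
    (hev : Γ.normalizedAdjMatrix m *ᵥ f = μ • f) : μ ≤ 1 - κ ^ 2 / 2 := by
  classical
  refine cheeger (hΓ.isSymm_normalizedAdjMatrix m) hrow (Γ.normalizedAdjMatrix_nonneg m) hκ
    (fun A hA => ?_) hf0 hf hev
  refine le_trans ?_ (Γ.card_outerBoundary_div_le m A)
  have hm : (0 : ℝ) < m := by
    obtain ⟨x, _⟩ := Function.ne_iff.1 hf0
    refine lt_of_le_of_ne (by positivity) fun h => ?_
    have := hrow x
    simp [normalizedAdjMatrix, ← h] at this
  have := h (A : Set V) (by simpa using hA)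
  rw [Set.ncard_coe_finset] at this
  rw [le_div_iff₀ hm]
  nlinarith [mul_le_mul_of_nonneg_right hκε (Nat.cast_nonneg (α := ℝ) A.card)]

theorem IsTwoSidedSpectralExpander.isVertexExpander (hΓ : Γ.Undirected)
    (hrow : ∀ x, ∑ y, Γ.normalizedAdjMatrix m x y = 1) {δ : ℝ} (hδ : 0 ≤ δ) (hδ1 : δ ≤ 1)
    (h : Γ.IsTwoSidedSpectralExpander m δ) : Γ.IsVertexExpander (δ / 2) := by
  classical
  intro A hA
  have hgap := dotProduct_mulVec_le_of_eigenvalue_le (hΓ.isSymm_normalizedAdjMatrix m) hrow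
    (c := 1 - δ) (by linarith) fun μ f h0 hs hev => by
      rcases eq_or_ne μ (-1) with rfl | hμ
      · linarith
      · exact (h μ f h0 hs hev hμ).2.le
  have h1 := conductance_of_gap (hΓ.isSymm_normalizedAdjMatrix m) hrow hδ hgap A.toFinset
    (by rwa [← Set.ncard_eq_toFinset_card', ← Nat.card_eq_fintype_card])
  have h2 := sum_compl_le_card_outerBoundary hΓ hrow A.toFinset
  rw [Set.ncard_eq_toFinset_card']
  rw [Set.coe_toFinset] at h2
  exact h1.trans h2

end EdgeCount

/-- `j` counts the plus signs. This is the source of the integrality of eigenvalues near `-1`. -/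
theorem Multiset.exists_sum_map_eq_of_eq_or_eq_neg {α : Type*} (S : Multiset α) (h : α → ℝ) (a : ℝ)
    (hh : ∀ s, h s = a ∨ h s = -a) : ∃ j : ℕ, (S.map h).sum = (2 * j - S.card) * a := by
  induction S using Multiset.induction_on with
  | empty => exact ⟨0, by simp⟩
  | cons s S ih =>
    obtain ⟨j, hj⟩ := ih
    rcases hh s with h1 | h1
    · exact ⟨j + 1, by simp only [map_cons, sum_cons, card_cons, hj, h1]; push_cast; ring⟩
    · exact ⟨j, by simp only [map_cons, sum_cons, card_cons, hj, h1]; push_cast; ring⟩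

/-! ### The four graphs on a group -/

namespace CayleyKind

variable {G : Type*} [Group G] {σ : G ≃* G} {S : Multiset G} {k l : CayleyKind}

/-- The label of an edge from `x` to `y`, if `σ` is an involution. -/
def label (σ : G ≃* G) : CayleyKind → G → G → G
  | cayley, x, y => x⁻¹ * y
  | cayleySum, x, y => x * y
  | twistedCayley, x, y => x⁻¹ * σ y
  | twistedCayleySum, x, y => x * σ y

/-- The twist by which the adjacency operator of the graph of kind `k` is precomposed. -/
def twist (σ : G ≃* G) : CayleyKind → G ≃* G
  | cayley => MulEquiv.refl G
  | cayleySum => MulEquiv.refl G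
  | twistedCayley => σ
  | twistedCayleySum => σ

theorem twist_twist (hσ : ∀ g, σ (σ g) = g) (k : CayleyKind) (x : G) :
    k.twist σ (k.twist σ x) = x := by
  cases k <;> simp [twist, hσ]

open Classical in
theorem graph_eq_count (hσ : ∀ g, σ (σ g) = g) (x y : G) :
    k.graph σ S x y = S.count (k.label σ x y) := by
  rw [Multiset.count_eq_card_filter_eq, graph]
  congr 1
  refine Multiset.filter_congr fun s _ => ?_
  have key : ∀ a : G, y = σ a ↔ σ y = a := fun a =>
    ⟨fun h => by rw [h, hσ], fun h => by rw [← h, hσ]⟩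
  cases k <;> simp only [step, label, key, inv_mul_eq_iff_eq_mul, eq_inv_mul_iff_mul_eq]

/-- Left translations are compatible with the graph, up to a permutation of the endpoints. -/
theorem exists_perm_graph_mul_left (hσ : ∀ g, σ (σ g) = g) (hu : (k.graph σ S).Undirected) (g : G) :
    ∃ β : Equiv.Perm G, ∀ x y, k.graph σ S (g * x) (β y) = k.graph σ S x y := by
  classical
  have hu' : ∀ x y, S.count (k.label σ x y) = S.count (k.label σ y x) := fun x y => by
    rw [← graph_eq_count hσ, ← graph_eq_count hσ, hu]
  simp only [graph_eq_count hσ]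
  cases k with
  | cayley =>
    refine ⟨Equiv.mulLeft g, fun x y => ?_⟩
    simp [label, mul_assoc]
  | cayleySum =>
    -- The label changes by conjugation with `g`, under which `S` is invariant because the graph is
    -- undirected.
    refine ⟨Equiv.mulRight g⁻¹, fun x y => ?_⟩
    have := hu' g (x * y * g⁻¹)
    simp only [label, Equiv.coe_mulRight] at this ⊢
    rw [← mul_assoc, inv_mul_cancel_right] at this
    rw [← this]
    simp only [mul_assoc]
  | twistedCayley =>
    refine ⟨Equiv.mulLeft (σ g), fun x y => ?_⟩
    simp [label, mul_assoc, hσ]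
  | twistedCayleySum =>
    -- Reversing edges at `1` shows that `S` is `σ`-invariant; together with reversal at `g` this
    -- gives invariance under conjugation.
    refine ⟨Equiv.mulRight (σ g)⁻¹, fun x y => ?_⟩
    have h1 := hu' g (σ x * y * (σ g)⁻¹)
    have h2 := hu' 1 (σ x * y)
    simp only [label, Equiv.coe_mulRight, map_mul, map_inv, map_one, hσ, mul_one, one_mul,
      inv_mul_cancel_right] at h1 h2 ⊢
    rw [h2, ← h1]
    simp only [mul_assoc]

theorem card_ne_zero_of_connected [Nontrivial G] (h : (k.graph σ S).Connected) : S.card ≠ 0 := by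
  intro h0
  obtain ⟨x, y, hxy⟩ := exists_pair_ne G
  have hno : ∀ a b, ¬ (k.graph σ S).Adj a b := by
    intro a b
    rw [Multiset.card_eq_zero.1 h0]
    simp [EdgeCount.Adj, graph]
  rcases (Relation.ReflTransGen.cases_head (h.2 x y)) with h1 | ⟨z, h1, _⟩
  · exact hxy h1
  · exact hno _ _ h1

variable [Fintype G]

theorem sum_graph_mul (f : G → ℝ) (x : G) :
    ∑ y, (k.graph σ S x y : ℝ) * f y = (S.map fun s => f (k.step σ x s)).sum := by
  classical
  induction S using Multiset.induction_on with
  | empty => simp [graph]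
  | cons s S ih =>
    have : ∀ y, (k.graph σ (s ::ₘ S) x y : ℝ) =
        k.graph σ S x y + if y = k.step σ x s then 1 else 0 := by
      intro y
      simp only [graph, Multiset.filter_cons]
      split_ifs <;> simp [add_comm]
    simp only [this, add_mul, Finset.sum_add_distrib, ih, Multiset.map_cons, Multiset.sum_cons]
    simp [add_comm]

theorem normalizedAdjMatrix_mulVec (f : G → ℝ) (x : G) :
    ((k.graph σ S).normalizedAdjMatrix S.card *ᵥ f) x =
      (S.map fun s => f (k.step σ x s)).sum / S.card := by
  rw [← sum_graph_mul, Finset.sum_div]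
  refine Finset.sum_congr rfl fun y _ => ?_
  simp only [EdgeCount.normalizedAdjMatrix, of_apply]
  ring

theorem sum_normalizedAdjMatrix (hS : S.card ≠ 0) (x : G) :
    ∑ y, (k.graph σ S).normalizedAdjMatrix S.card x y = 1 := by
  have := normalizedAdjMatrix_mulVec (k := k) (σ := σ) (S := S) (fun _ => 1) x
  simp only [mulVec, dotProduct, mul_one] at this
  rw [this]
  simp [hS]

/-- The four adjacency operators have the same singular values. -/
theorem dotProduct_mulVec_comp_twist (hσ : ∀ g, σ (σ g) = g) (f h : G → ℝ) (k l : CayleyKind) :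
    ((k.graph σ S).normalizedAdjMatrix S.card *ᵥ (f ∘ k.twist σ)) ⬝ᵥ
        ((k.graph σ S).normalizedAdjMatrix S.card *ᵥ (h ∘ k.twist σ)) =
      ((l.graph σ S).normalizedAdjMatrix S.card *ᵥ (f ∘ l.twist σ)) ⬝ᵥ
        ((l.graph σ S).normalizedAdjMatrix S.card *ᵥ (h ∘ l.twist σ)) := by
  -- The twist cancels `σ`, and the substitution of `x⁻¹` for `x` turns sum graphs into Cayley
  -- graphs.
  suffices H : ∀ k : CayleyKind, ((k.graph σ S).normalizedAdjMatrix S.card *ᵥ (f ∘ k.twist σ)) ⬝ᵥ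
        ((k.graph σ S).normalizedAdjMatrix S.card *ᵥ (h ∘ k.twist σ)) =
      ∑ x, ((S.map fun s => f (x * s)).sum / S.card) * ((S.map fun s => h (x * s)).sum / S.card) by
    rw [H, H]
  intro k
  simp only [dotProduct, normalizedAdjMatrix_mulVec]
  cases k with
  | cayley => simp [step, twist]
  | cayleySum =>
    rw [← Equiv.sum_comp (Equiv.inv G)]
    simp [step, twist]
  | twistedCayley => simp only [step, twist, Function.comp_apply, hσ]
  | twistedCayleySum =>
    rw [← Equiv.sum_comp (Equiv.inv G)]
    simp only [step, twist, Function.comp_apply, hσ, Equiv.inv_apply, inv_inv]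

/-- Up to sign, the adjacency operators of undirected graphs of two kinds share their nontrivial
eigenvalues. -/
theorem exists_eigenvector_or_neg (hσ : ∀ g, σ (σ g) = g) (hS : S.card ≠ 0)
    (hk : (k.graph σ S).Undirected) (hl : (l.graph σ S).Undirected)
    {μ : ℝ} {f : G → ℝ} (hf0 : f ≠ 0) (hf : ∑ v, f v = 0)
    (hev : (l.graph σ S).normalizedAdjMatrix S.card *ᵥ f = μ • f) :
    ∃ ν : ℝ, (ν = μ ∨ ν = -μ) ∧ ∃ g : G → ℝ, g ≠ 0 ∧ ∑ v, g v = 0 ∧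
      (k.graph σ S).normalizedAdjMatrix S.card *ᵥ g = ν • g := by
  have hMk := hk.isSymm_normalizedAdjMatrix S.card
  have hMl := hl.isSymm_normalizedAdjMatrix S.card
  set K := (k.graph σ S).normalizedAdjMatrix S.card with hK
  set L := (l.graph σ S).normalizedAdjMatrix S.card with hL
  have hinv : ∀ (j : CayleyKind) (u : G → ℝ), (u ∘ j.twist σ) ∘ j.twist σ = u := fun j u => by
    ext x
    simp [twist_twist hσ]
  have hdot : ∀ (j : CayleyKind) (u w : G → ℝ), (u ∘ j.twist σ) ⬝ᵥ (w ∘ j.twist σ) = u ⬝ᵥ w :=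
    fun j u w => Equiv.sum_comp (j.twist σ).toEquiv fun x => u x * w x
  set f' := f ∘ l.twist σ with hf'
  set g := f' ∘ k.twist σ with hg
  have hsq : K *ᵥ (K *ᵥ g) = (μ ^ 2) • g := by
    refine dotProduct_eq _ _ fun w => ?_
    set h := w ∘ k.twist σ with hh
    have hw : w = h ∘ k.twist σ := (hinv k w).symm
    rw [dotProduct_comm, dotProduct_mulVec_comm_of_isSymm hMk, hw, hg,
      dotProduct_mulVec_comp_twist hσ f' h k l, hf', hinv l f, ← hL, hev, smul_dotProduct,
      dotProduct_mulVec_comm_of_isSymm hMl, hev, dotProduct_smul, smul_dotProduct, hdot k,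
      ← hdot l _ h, hinv l f, dotProduct_comm]
    simp only [smul_eq_mul]
    ring
  have hg0 : g ≠ 0 := by
    intro h0
    apply hf0
    rw [← hinv l f, ← hf', ← hinv k f', ← hg, h0]
    rfl
  have hgs : ∑ v, g v = 0 := by
    rw [← hf]
    exact (Equiv.sum_comp (k.twist σ).toEquiv f').trans (Equiv.sum_comp (l.twist σ).toEquiv f)
  -- As `(K - μ) (K + μ) g = 0`, either `g` or `K g + μ g` is the required eigenvector.
  by_cases h : K *ᵥ g + μ • g = 0
  · exact ⟨-μ, Or.inr rfl, g, hg0, hgs, by rw [neg_smul]; exact eq_neg_of_add_eq_zero_left h⟩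
  · refine ⟨μ, Or.inl rfl, _, h, ?_, ?_⟩
    · simp only [Pi.add_apply, Pi.smul_apply, Finset.sum_add_distrib,
        sum_mulVec_eq_sum hMk (sum_normalizedAdjMatrix hS), ← Finset.smul_sum, hgs]
      simp
    · rw [mulVec_add, hsq, mulVec_smul, smul_add, smul_smul, sq, add_comm]

/-- The interval is symmetric, so signs do not matter except for the exempt eigenvalue `-1` of the
first graph. It could only give `1` on the second, which connectedness excludes. -/
theorem isTwoSidedSpectralExpander_transfer (hσ : ∀ g, σ (σ g) = g) (hS : S.card ≠ 0)
    (hk : (k.graph σ S).Undirected) (hl : (l.graph σ S).Undirected) (hlc : (l.graph σ S).Connected)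
    {δ : ℝ} (h : (k.graph σ S).IsTwoSidedSpectralExpander S.card δ) :
    (l.graph σ S).IsTwoSidedSpectralExpander S.card δ := by
  intro μ f hf0 hf hev hμ
  obtain ⟨ν, hν, g, hg0, hg, hgev⟩ := exists_eigenvector_or_neg hσ hS hk hl hf0 hf hev
  have hν1 : ν ≠ -1 := by
    rintro rfl
    have h1 : μ = 1 := by
      rcases hν with h | h
      · exact absurd h.symm hμ
      · linarith
    rw [h1, one_smul] at hev
    exact hf0 (hlc.eq_zero_of_mulVec_eq_self (sum_normalizedAdjMatrix hS) hf hev)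
  have := h ν g hg0 hg hgev hν1
  rcases hν with rfl | rfl
  · exact this
  · constructor <;> linarith

/-- An eigenvalue that is close to `-1` compared with the spectral gap at `1` is, up to scaling,
an even integer minus one. -/
theorem exists_nat_of_eigenvalue_near_neg_one (hσ : ∀ g, σ (σ g) = g) (hS : S.card ≠ 0)
    (hk : (k.graph σ S).Undirected) {η : ℝ} (hη : 0 < η)
    (hgap : ∀ f : G → ℝ, ∑ v, f v = 0 →
      f ⬝ᵥ (k.graph σ S).normalizedAdjMatrix S.card *ᵥ f ≤ (1 - η) * (f ⬝ᵥ f))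
    {μ : ℝ} (hμ : μ ≤ -1 + 1 / 100 * η) {f : G → ℝ} (hf0 : f ≠ 0)
    (hev : (k.graph σ S).normalizedAdjMatrix S.card *ᵥ f = μ • f) :
    ∃ j : ℕ, (μ + 1) * S.card = 2 * j := by
  classical
  have hM := hk.isSymm_normalizedAdjMatrix S.card
  have hrow := sum_normalizedAdjMatrix (k := k) (σ := σ) hS
  set M := (k.graph σ S).normalizedAdjMatrix S.card with hMdef
  let E : Submodule ℝ (G → ℝ) := Module.End.eigenspace (Matrix.toLin' M) μ
  have memE : ∀ u : G → ℝ, u ∈ E ↔ M *ᵥ u = μ • u := fun u => by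
    rw [Module.End.mem_eigenspace_iff, Matrix.toLin'_apply]
  have hE : ∀ u ∈ E, 99 / 100 * (u ⬝ᵥ u) * Fintype.card G ≤ (∑ x, |u x|) ^ 2 := by
    intro u hu
    have := sq_sum_abs_ge_of_gap hM hrow (EdgeCount.normalizedAdjMatrix_nonneg _ _) hη hgap hμ
      ((memE u).1 hu)
    norm_num at this ⊢
    exact this
  have hff : f ⬝ᵥ f ≠ 0 := mt dotProduct_self_eq_zero.1 hf0
  have htr : ∀ g : G, f g = f 1 ∨ f g = -f 1 := by
    intro g
    obtain ⟨β, hβ⟩ := exists_perm_graph_mul_left hσ hk g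
    have h1 := (comp_eq_comp_of_gap hM hgap (by linarith) hev (Equiv.mulLeft g) β fun x y => by
      simp [hMdef, EdgeCount.normalizedAdjMatrix, hβ]).2
    set fg := f ∘ Equiv.mulLeft g with hfg
    have hnorm : fg ⬝ᵥ fg = f ⬝ᵥ f := Equiv.sum_comp (Equiv.mulLeft g) fun x => f x * f x
    set c := (f ⬝ᵥ fg) / (f ⬝ᵥ f) with hc
    -- The component of the translate orthogonal to `f` stays in the eigenspace, which is a line, so
    -- it vanishes; `c = ±1` because translation preserves the norm.
    have h2 : fg - c • f = 0 :=
      eq_zero_of_dotProduct_eq_zero_of_abs_nearly_const E hE ((memE f).2 hev)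
        (E.sub_mem ((memE fg).2 h1) (E.smul_mem c ((memE f).2 hev))) hf0 (by
          rw [dotProduct_sub, dotProduct_smul, smul_eq_mul, hc]
          field_simp
          ring)
    have h3 : fg = c • f := sub_eq_zero.1 h2
    have h4 : c ^ 2 = 1 := by
      rw [h3, smul_dotProduct, dotProduct_smul, smul_eq_mul, smul_eq_mul] at hnorm
      exact mul_right_cancel₀ hff (by linear_combination hnorm)
    have h5 : f g = c * f 1 := by
      have := congrFun h3 1
      simpa [hfg] using this
    rcases (sq_eq_sq_iff_eq_or_eq_neg.1 (h4.trans (one_pow 2).symm)) with h | h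
    · left; rw [h5, h, one_mul]
    · right; rw [h5, h, neg_one_mul]
  have hf1 : f 1 ≠ 0 := by
    intro h
    refine hf0 (funext fun g => ?_)
    rcases htr g with h' | h' <;> simp [h', h]
  obtain ⟨j, hj⟩ := S.exists_sum_map_eq_of_eq_or_eq_neg (fun s => f (k.step σ 1 s)) (f 1)
    fun s => htr _
  refine ⟨j, ?_⟩
  have h1 := congrFun hev 1
  have hS' : (S.card : ℝ) ≠ 0 := by exact_mod_cast hS
  rw [hMdef, normalizedAdjMatrix_mulVec, hj, Pi.smul_apply, smul_eq_mul, div_eq_iff hS'] at h1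
  exact mul_right_cancel₀ hf1 (by linear_combination -h1)

/-- One-sided expansion of the graphs of all four kinds is two-sided. -/
theorem isTwoSidedSpectralExpander_of_eigenvalue_le (hσ : ∀ g, σ (σ g) = g) (hS : S.card ≠ 0)
    (hk : (k.graph σ S).Undirected) {η δ : ℝ} (hη : 0 < η) (hη1 : η ≤ 1)
    (h : ∀ (μ : ℝ) (f : G → ℝ), f ≠ 0 → ∑ v, f v = 0 →
      (k.graph σ S).normalizedAdjMatrix S.card *ᵥ f = μ • f → μ ≤ 1 - η)
    (hδη : δ ≤ 1 / 100 * η) (hδS : δ * S.card < 2) :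
    (k.graph σ S).IsTwoSidedSpectralExpander S.card δ := by
  intro μ f hf0 hf hev hμ
  refine ⟨?_, by linarith [h μ f hf0 hf hev]⟩
  by_contra! hle
  have hgap := dotProduct_mulVec_le_of_eigenvalue_le (hk.isSymm_normalizedAdjMatrix S.card)
    (sum_normalizedAdjMatrix hS) (by linarith) h
  obtain ⟨j, hj⟩ := exists_nat_of_eigenvalue_near_neg_one hσ hS hk hη hgap (by linarith) hf0 hev
  have hS' : (0 : ℝ) < S.card := by exact_mod_cast Nat.pos_of_ne_zero hS
  have h1 : (μ + 1) * S.card ≤ δ * S.card := mul_le_mul_of_nonneg_right (by linarith) hS'.le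
  have h2 : j < 1 := by
    have : (j : ℝ) < 1 := by linarith
    exact_mod_cast this
  have h3 : (μ + 1) * S.card = 0 := by
    rw [hj, Nat.lt_one_iff.1 h2]
    simp
  rcases mul_eq_zero.1 h3 with h4 | h4
  · exact hμ (by linarith)
  · exact hS'.ne' h4

end CayleyKind

/-! ### The main theorem -/

theorem mainTheorem3 (d : ℕ) (ε : ℝ) (hε : 0 < ε) :
    ∃ δ : ℝ, 0 < δ ∧
      ∀ (G : Type*) [Group G] [Fintype G] (σ : G ≃* G) (S : Multiset G) (k l : CayleyKind),
        4 ≤ Fintype.card G →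
        (∀ g, σ (σ g) = g) →
        S.card ≤ d →
        (k.graph σ S).Undirected → (k.graph σ S).Connected →
        (l.graph σ S).Undirected → (l.graph σ S).Connected →
        ((k = .cayleySum ∧ l = .twistedCayley) ∨ (k = .twistedCayley ∧ l = .cayleySum) →
          S.map (fun s => s⁻¹) = S) →
        ((k.graph σ S).IsVertexExpander ε ∨
          (k.graph σ S).IsTwoSidedSpectralExpander S.card ε) →
        (l.graph σ S).IsVertexExpander δ ∧
          (l.graph σ S).IsTwoSidedSpectralExpander S.card δ := by
  have hd : (0 : ℝ) < d + 1 := by positivity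
  -- This gives `κ * |S| ≤ ε`; the denominator is positive even for `d = 0`.
  set κ : ℝ := ε / (d + 1) with hκ
  have hκ0 : 0 < κ := div_pos hε hd
  set η : ℝ := min 1 (κ ^ 2 / 2) with hη
  have hη0 : 0 < η := lt_min one_pos (by positivity)
  have hη1 : η ≤ 1 := min_le_left _ _
  -- The three bounds serve the spectral hypothesis, the near-constancy of moduli, and `δ * |S| <
  -- 2`. The final constant is `δ / 2` because of the easy Cheeger bound.
  set δ : ℝ := min ε (min (1 / 100 * η) (1 / (d + 1))) with hδ
  have hδ0 : 0 < δ := lt_min hε (lt_min (by positivity) (by positivity))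
  have hδε : δ ≤ ε := min_le_left _ _
  have hδη : δ ≤ 1 / 100 * η := (min_le_right _ _).trans (min_le_left _ _)
  have hδd : δ ≤ 1 / (d + 1) := (min_le_right _ _).trans (min_le_right _ _)
  refine ⟨δ / 2, by positivity, ?_⟩
  intro G _ _ σ S k l hG hσ hSd hk hkc hl hlc _ hexp
  have : Nontrivial G := Fintype.one_lt_card_iff_nontrivial.1 (by omega)
  have hS := CayleyKind.card_ne_zero_of_connected hkc
  have hSd' : (S.card : ℝ) ≤ d := by exact_mod_cast hSd
  have hkδ : (k.graph σ S).IsTwoSidedSpectralExpander S.card δ := by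
    rcases hexp with hv | hs
    · refine CayleyKind.isTwoSidedSpectralExpander_of_eigenvalue_le hσ hS hk hη0 hη1
        (fun μ f hf0 hf hev => ?_) hδη ?_
      · have := hv.eigenvalue_le hk (CayleyKind.sum_normalizedAdjMatrix hS) hκ0.le
          (by rw [hκ, div_mul_eq_mul_div, div_le_iff₀ hd]; nlinarith) hf0 hf hev
        linarith [min_le_right 1 (κ ^ 2 / 2)]
      · have h1 : δ * (d + 1) ≤ 1 := (le_div_iff₀ hd).1 hδd
        nlinarith
    · exact hs.mono hδε
  have hlδ := CayleyKind.isTwoSidedSpectralExpander_transfer hσ hS hk hl hlc hkδ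
  exact ⟨hlδ.isVertexExpander hl (CayleyKind.sum_normalizedAdjMatrix hS) hδ0.le (by linarith),
    hlδ.mono (by linarith)⟩
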